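/- Let $n\ge 2$, $\alpha>0$ and $0\le\theta\le 1$. Let the random weight profile $X=(X_1,\dots,X_n)$ have the symmetric Dirichlet distribution $\mathrm{Dir}(\alpha,\dots,\alpha)$ on the simplex $\{x_i>0,\ \sum_i x_i=1\}$, i.e. density $p(x)=\frac{\Gamma(n\alpha)}{\Gamma(\alpha)^n}\prod_{i=1}^n x_i^{\alpha-1}$ with respect to Lebesgue measure in $(x_1,\dots,x_{n-1})$, where $x_n=1-\sum_{i<n}x_i$. For weights $x$, a coalition $C\subseteq N=\{1,\dots,n\}$ is winning under the quota rule if $\sum_{i\in C}x_i/\sum_{i\in N}x_i\ge\theta$, and winning under the strict quota rule if $\sum_{i\in C}x_i/\sum_{i\in N}x_i>\theta$. For either rule let $f_x(C)\in\{0,1\}$ indicate that $C$ is winning, and let $$\mathsf B_1^\theta(x)=\frac1{2^{n-1}}\sum_{C\subseteq N\setminus\{1\}}\bigl(f_x(C\cup\{1\})-f_x(C)\bigr)$$ be the Banzhaf index of agent $1$. For $1\le k\le n-2$ let $\Delta(h;k,\alpha)$ be the distribution function of the $\mathrm{Beta}(k\alpha,(n-1-k)\alpha)$ distribution, that is, $$\Delta(h;k,\alpha)=\frac{\int_0^h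 t^{k\alpha-1}(1-t)^{(n-1-k)\alpha-1}\,dt}{\int_0^1 t^{k\alpha-1}(1-t)^{(n-1-k)\alpha-1}\,dt}\quad(0\le h\le 1),$$ with $\Delta(h;k,\alpha)=0$ for $h<0$ and $\Delta(h;k,\alpha)=1$ for $h>1$. Write $\mathsf B^\theta_{1,c}$ for the expected value of $\mathsf B_1^\theta(X)$ conditioned on $X_1=c$, where $0<c<1$. Consider the following list of formulas. 1. If $0\le\theta\le\frac12$, then $$\mathsf B^\theta_{1,c}=\begin{cases}\displaystyle\sum_{k=1}^{n-2}\frac{\binom{n-1}{k}}{2^{n-1}}\Bigl(\Delta\bigl(\tfrac{\theta}{1-c};k,\alpha\bigr)-\Delta\bigl(\tfrac{\theta-c}{1-c};k,\alpha\bigr)\Bigr), & 0<c\le\theta,\\[2ex]\displaystyle\sum_{k=1}^{n-2}\frac{\binom{n-1}{k}}{2^{n-1}}\Bigl(\Delta\bigl(\tfrac{\theta}{1-c};k,\alpha\bigr)-\Delta\bigl(\tfrac{\theta-c}{1-c};k,\alpha\bigr)\Bigr)+\frac1{2^{n-1}}, & \theta<c<1-\theta,\\[2ex]1, & 1-\theta\le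 c<1.\end{cases}$$ 2. If $\frac12<\theta\le1$, then $$\mathsf B^\theta_{1,c}=\begin{cases}\displaystyle\sum_{k=1}^{n-2}\frac{\binom{n-1}{k}}{2^{n-1}}\Bigl(\Delta\bigl(\tfrac{\theta}{1-c};k,\alpha\bigr)-\Delta\bigl(\tfrac{\theta-c}{1-c};k,\alpha\bigr)\Bigr), & 0<c<1-\theta,\\[2ex]\displaystyle\sum_{k=1}^{n-2}\frac{\binom{n-1}{k}}{2^{n-1}}\Bigl(1-\Delta\bigl(\tfrac{\theta-c}{1-c};k,\alpha\bigr)\Bigr)+\frac1{2^{n-1}}, & 1-\theta\le c\le\theta,\ 0<c<1,\\[2ex]1, & \theta<c<1.\end{cases}$$ These formulas hold for the quota rule whenever $0<\theta\le1$, and for the strict quota rule whenever $0\le\theta<1$, in each of the following two senses. (a) If $\mathsf B^\theta_{1,c}$ is the integral of $\mathsf B_1^\theta$ against the regular conditional distribution of $X$ given $X_1=c$, the formulas hold for almost every $c$ with respect to the law of $X_1$. (b) If $\mathsf B^\theta_{1,c}$ is computed with the conditional density of the remaining coordinates, that is, $\mathsf B^\theta_{1,c}=\int \mathsf B_1^\theta(c,z)\,p(c,z)\,dz\big/\int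 p(c,z)\,dz$ with $z$ ranging over the coordinates $(x_2,\dots,x_{n-1})$ (and $x_n$ determined by them), the formulas hold for every $c\in(0,1)$, with the following exceptions: for the quota rule, the points $c=\theta$ and $c=1-\theta$; for the strict quota rule, only $c=\frac12$ when $\theta=\frac12$. -/

import Mathlib

open MeasureTheory ProbabilityTheory

noncomputable section

/-- The decision function of the weighted quota rule with relative quota `θ` and weights `w`:
a coalition is winning when its share of the total weight is at least `θ`. -/
def quotaRule {n : ℕ} (θ : ℝ) (w : Fin n → ℝ) (C : Finset (Fin n)) : ℝ :=
  if θ ≤ (∑ i ∈ C, w i) / ∑ i, w i then 1 else 0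

/-- The same rule with a strict threshold: a coalition is winning when its share of the total
weight exceeds `θ`. -/
def strictQuotaRule {n : ℕ} (θ : ℝ) (w : Fin n → ℝ) (C : Finset (Fin n)) : ℝ :=
  if θ < (∑ i ∈ C, w i) / ∑ i, w i then 1 else 0

/-- The Banzhaf index of agent `i` in the simple game with decision function `f`. -/
def banzhafIndex {n : ℕ} (f : Finset (Fin n) → ℝ) (i : Fin n) : ℝ :=
  1 / 2 ^ (n - 1) * ∑ C ∈ (Finset.univ.erase i).powerset, (f (insert i C) - f C)

/-- The density of the Dirichlet distribution with parameters `a`, as a function of the point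
`x` of the simplex: `∏ xᵢ ^ (aᵢ - 1) / B(a)` with `B(a) = ∏ Γ(aᵢ) / Γ(∑ aᵢ)`. -/
def dirichletDensity {n : ℕ} (a x : Fin n → ℝ) : ℝ :=
  if ∀ i, 0 < x i then
    1 / ((∏ i, Real.Gamma (a i)) / Real.Gamma (∑ i, a i)) * ∏ i, x i ^ (a i - 1)
  else 0

/-- The point of the hyperplane `∑ xᵢ = 1` with given first coordinates (all but the last). -/
def simplexPoint {d : ℕ} (y : Fin d → ℝ) : Fin (d + 1) → ℝ :=
  Fin.snoc y (1 - ∑ i, y i)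

/-- The Dirichlet distribution on the simplex in `ℝ ^ (d + 1)`: the density is taken with respect
to Lebesgue measure in the first `d` coordinates. -/
def dirichletMeasure {d : ℕ} (a : Fin (d + 1) → ℝ) : Measure (Fin (d + 1) → ℝ) :=
  ((volume : Measure (Fin d → ℝ)).withDensity
    fun y => ENNReal.ofReal (dirichletDensity a (simplexPoint y))).map simplexPoint

/-- The elementary conditional expectation `E[g(X) | X₁ = c]` for `X` with the Dirichlet
distribution, by means of the conditional density of the remaining coordinates (joint density
divided by marginal density) at the point `c`. -/
def dirichletCondMean (m : ℕ) (a : Fin (m + 2) → ℝ) (g : (Fin (m + 2) → ℝ) → ℝ) (c : ℝ) : ℝ :=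
  (∫ z : Fin m → ℝ, g (simplexPoint (Fin.cons c z : Fin (m + 1) → ℝ)) *
      dirichletDensity a (simplexPoint (Fin.cons c z : Fin (m + 1) → ℝ))) /
    ∫ z : Fin m → ℝ, dirichletDensity a (simplexPoint (Fin.cons c z : Fin (m + 1) → ℝ))

/-- The incomplete Beta function `Bt(h; p, q) = ∫₀ʰ t ^ (p - 1) (1 - t) ^ (q - 1) dt` for
`0 ≤ h ≤ 1`, extended to be constant on each side of `[0, 1]`. -/
def incompleteBeta (h p q : ℝ) : ℝ :=
  ∫ t in (0 : ℝ)..(max 0 (min h 1)), t ^ (p - 1) * (1 - t) ^ (q - 1)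

/-- The Beta function as an integral. -/
def betaFunction (p q : ℝ) : ℝ :=
  ∫ t in (0 : ℝ)..1, t ^ (p - 1) * (1 - t) ^ (q - 1)

/-- `Δ(h; k, α)`, for `n` agents: the distribution function of `Beta(kα, (n - 1 - k)α)`. -/
def betaCdf (n : ℕ) (h : ℝ) (k : ℕ) (α : ℝ) : ℝ :=
  incompleteBeta h (k * α) (((n : ℝ) - 1 - k) * α) / betaFunction (k * α) (((n : ℝ) - 1 - k) * α)

/-- `v` is the value that the piecewise formula assigns to the expected Banzhaf index of the first
of `n` agents, given that this agent has weight `c`. -/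
def IsBanzhafValue (n : ℕ) (α θ c v : ℝ) : Prop :=
  (θ ≤ 1 / 2 →
    (0 < c → c ≤ θ →
      v = ∑ k ∈ Finset.Icc 1 (n - 2), ((n - 1).choose k : ℝ) / 2 ^ (n - 1) *
        (betaCdf n (θ / (1 - c)) k α - betaCdf n ((θ - c) / (1 - c)) k α)) ∧
    (θ < c → c < 1 - θ →
      v = (∑ k ∈ Finset.Icc 1 (n - 2), ((n - 1).choose k : ℝ) / 2 ^ (n - 1) *
        (betaCdf n (θ / (1 - c)) k α - betaCdf n ((θ - c) / (1 - c)) k α)) +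
        1 / 2 ^ (n - 1)) ∧
    (1 - θ ≤ c → c < 1 → v = 1)) ∧
  (1 / 2 < θ →
    (0 < c → c < 1 - θ →
      v = ∑ k ∈ Finset.Icc 1 (n - 2), ((n - 1).choose k : ℝ) / 2 ^ (n - 1) *
        (betaCdf n (θ / (1 - c)) k α - betaCdf n ((θ - c) / (1 - c)) k α)) ∧
    (0 < c → c < 1 → 1 - θ ≤ c → c ≤ θ →
      v = (∑ k ∈ Finset.Icc 1 (n - 2), ((n - 1).choose k : ℝ) / 2 ^ (n - 1) *
        (1 - betaCdf n ((θ - c) / (1 - c)) k α)) + 1 / 2 ^ (n - 1)) ∧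
    (θ < c → c < 1 → v = 1))

end

/-! Write n = m + 2 and r = 1 - c. Given X₁ = c, the other n - 1 weights follow a symmetric
Dirichlet law on the simplex of total r. By aggregation, the weight of a nonempty proper coalition C
of the other agents, divided by r, is Beta(kα, (n-1-k)α) with k = |C|
(`lintegral_comp_sum_snoc_scaledDirichlet`). The probability that agent 1 swings C is therefore
Δ(θ/r) - Δ((θ-c)/r), which depends only on k, and grouping coalitions by size produces the binomial
sum.

The two extreme coalitions have deterministic weight. Agent 1 swings the empty one iff c wins, and
the coalition of all others iff 1 - c loses; each contributes 0 or 1/2^(n-1). This gives one formula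
for all c (`dirichletCondMean_banzhafIndex_eq_sum`). The piecewise version follows by comparing c
and 1 - c with θ and using that Δ is 0 below 0 and 1 above 1 (`isBanzhafValue_dirichletCondMean`).

Both rules are treated at once through a set U of winning shares with (θ, ∞) ⊆ U ⊆ [θ, ∞). Beta laws
have no atoms, so the rules can differ only in the extreme coalitions, at c = θ and c = 1 - θ. For
the strict rule the formula is right at these points too, except at c = θ = 1/2, where the first and
third clauses of the case θ ≤ 1/2 overlap and contradict each other.

For sense (a), Fubini shows that the conditional-density mean and the regular conditional
expectation have equal integrals over every event {X₁ ∈ s}, so they agree almost everywhere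
(`integral_condDistrib_ae_eq_dirichletCondMean`). The law of X₁ is absolutely continuous, so the
exceptional points are null. -/

noncomputable section

/-! ### Truncated powers and one-dimensional Beta integrals. -/

/-- The power `x ^ (a - 1)` on the positive half-line, extended by zero. -/
def powWeight (a x : ℝ) : ENNReal :=
  if 0 < x then ENNReal.ofReal (x ^ (a - 1)) else 0

@[fun_prop]
lemma measurable_powWeight (a : ℝ) : Measurable (powWeight a) :=
  Measurable.ite measurableSet_Ioi (by fun_prop) (by fun_prop)

lemma powWeight_of_nonpos {a x : ℝ} (hx : x ≤ 0) : powWeight a x = 0 := if_neg hx.not_gt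

lemma powWeight_ne_top (a x : ℝ) : powWeight a x ≠ ⊤ := by
  unfold powWeight; split_ifs <;> simp

lemma powWeight_ne_zero {a x : ℝ} (hx : 0 < x) : powWeight a x ≠ 0 := by
  simpa [powWeight, hx] using Real.rpow_pos_of_pos hx _

lemma powWeight_mul {a r : ℝ} (hr : 0 < r) (t : ℝ) :
    powWeight a (r * t) = powWeight a r * powWeight a t := by
  by_cases ht : 0 < t
  · have := mul_pos hr ht
    simp only [powWeight, hr, ht, this, if_true]
    rw [Real.mul_rpow hr.le ht.le, ENNReal.ofReal_mul (by positivity)]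
  · have : r * t ≤ 0 := mul_nonpos_of_nonneg_of_nonpos hr.le (not_lt.1 ht)
    rw [powWeight_of_nonpos this, powWeight_of_nonpos (not_lt.1 ht), mul_zero]

lemma ofReal_mul_powWeight_mul_powWeight {p q r : ℝ} (hr : 0 < r) :
    ENNReal.ofReal r * (powWeight p r * powWeight q r) = powWeight (p + q) r := by
  simp only [powWeight, hr, if_true]
  rw [← ENNReal.ofReal_mul (by positivity), ← ENNReal.ofReal_mul hr.le]
  congr 1
  nth_rewrite 1 [← Real.rpow_one r]
  rw [← Real.rpow_add hr, ← Real.rpow_add hr]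
  congr 1
  ring

lemma powWeight_mul_powWeight_one_sub {p q : ℝ} (hp : 0 < p) (hq : 0 < q) (t : ℝ) :
    powWeight p t * powWeight q (1 - t) = ENNReal.ofReal (beta p q) * betaPDF p q t := by
  rcases le_or_gt t 0 with h0 | h0
  · rw [powWeight_of_nonpos h0, betaPDF_eq_zero_of_nonpos h0, zero_mul, mul_zero]
  rcases le_or_gt 1 t with h1 | h1
  · rw [powWeight_of_nonpos (sub_nonpos.2 h1), betaPDF_eq_zero_of_one_le h1, mul_zero, mul_zero]
  · have h1' : 0 < 1 - t := sub_pos.2 h1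
    have hb := beta_pos hp hq
    rw [betaPDF_of_pos_lt_one h0 h1, ← ENNReal.ofReal_mul hb.le]
    simp only [powWeight, h0, h1', if_true]
    rw [← ENNReal.ofReal_mul (by positivity)]
    congr 1
    field_simp

lemma lintegral_eq_ofReal_mul_lintegral_comp_mul {r : ℝ} (hr : 0 < r) {f : ℝ → ENNReal}
    (hf : Measurable f) : ∫⁻ s, f s = ENNReal.ofReal r * ∫⁻ t, f (r * t) := by
  conv_lhs => rw [← Real.smul_map_volume_mul_left hr.ne']
  rw [lintegral_smul_measure, lintegral_map hf (by fun_prop), abs_of_pos hr, smul_eq_mul]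

/-- Substitute s = r t: by homogeneity the powers of r factor out and the Beta(p, q) density in t
remains. -/
lemma lintegral_mul_powWeight_mul_powWeight {p q r : ℝ} (hp : 0 < p) (hq : 0 < q) (hr : 0 < r)
    {F : ℝ → ENNReal} (hF : Measurable F) :
    ∫⁻ s, F s * (powWeight p s * powWeight q (r - s)) =
      ENNReal.ofReal (beta p q) * powWeight (p + q) r * ∫⁻ t, F (r * t) ∂(betaMeasure p q) := by
  have hm : Measurable (betaPDF p q) := (measurable_betaPDFReal p q).ennreal_ofReal
  rw [lintegral_eq_ofReal_mul_lintegral_comp_mul hr (by fun_prop), betaMeasure,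
    lintegral_withDensity_eq_lintegral_mul _ hm (by fun_prop),
    ← ofReal_mul_powWeight_mul_powWeight hr]
  have : ∀ t, F (r * t) * (powWeight p (r * t) * powWeight q (r - r * t)) =
      (powWeight p r * powWeight q r * ENNReal.ofReal (beta p q)) *
        (betaPDF p q * fun t => F (r * t)) t := by
    intro t
    have h : r - r * t = r * (1 - t) := by ring
    rw [h, powWeight_mul hr, powWeight_mul hr, Pi.mul_apply]
    calc _ = F (r * t) * (powWeight p r * powWeight q r) *
          (powWeight p t * powWeight q (1 - t)) := by ring
      _ = _ := by rw [powWeight_mul_powWeight_one_sub hp hq]; ring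
  simp_rw [this]
  rw [lintegral_const_mul _ (by fun_prop)]
  ring

lemma lintegral_powWeight_mul_powWeight {p q : ℝ} (hp : 0 < p) (hq : 0 < q) (r : ℝ) :
    ∫⁻ s, powWeight p s * powWeight q (r - s) =
      ENNReal.ofReal (beta p q) * powWeight (p + q) r := by
  rcases lt_or_ge 0 r with hr | hr
  · have := lintegral_mul_powWeight_mul_powWeight hp hq hr (F := fun _ => 1) measurable_const
    have hP := isProbabilityMeasureBeta hp hq
    simpa using this
  -- For r ≤ 0 the numbers s and r - s are never both positive, so the truncation annihilates the
  -- integrand.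
  · rw [powWeight_of_nonpos hr, mul_zero]
    refine (lintegral_congr fun s => ?_).trans lintegral_zero
    rcases le_or_gt s 0 with hs | hs
    · rw [powWeight_of_nonpos hs, zero_mul]
    · rw [powWeight_of_nonpos (by linarith : r - s ≤ 0), mul_zero]

/-! ### Dirichlet integrals in several variables. -/

lemma lintegral_fin_succ {p : ℕ} (f : (Fin (p + 1) → ℝ) → ENNReal) (hf : Measurable f) :
    ∫⁻ x, f x = ∫⁻ a : ℝ, ∫⁻ y : Fin p → ℝ, f (Fin.cons a y) := by
  rw [← (volume_preserving_piFinSuccAbove (fun _ : Fin (p + 1) => ℝ) 0).symm.lintegral_comp hf,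
    Measure.volume_eq_prod, lintegral_prod _ (by fun_prop)]
  simp [MeasurableEquiv.piFinSuccAbove_symm_apply, Fin.insertNthEquiv]

lemma measurable_fin_cons {p : ℕ} :
    Measurable fun x : ℝ × (Fin p → ℝ) => (Fin.cons x.1 x.2 : Fin (p + 1) → ℝ) := by
  refine measurable_pi_lambda _ fun i => ?_
  refine Fin.cases ?_ (fun i => ?_) i
  · simpa using measurable_fst
  · simp only [Fin.cons_succ]; fun_prop

/-- Peeling off a coordinate a leaves the same integral with total r - a, so each induction step is
one Beta convolution. All real r are needed, since r - a may have either sign. That K is nonzero and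
finite is what later makes the slice measure normalizable. -/
lemma exists_lintegral_prod_powWeight_fin {α : ℝ} (hα : 0 < α) (p : ℕ) :
    ∃ K : ENNReal, K ≠ 0 ∧ K ≠ ⊤ ∧ ∀ r : ℝ,
      ∫⁻ y : Fin p → ℝ, (∏ i, powWeight α (y i)) * powWeight α (r - ∑ i, y i) =
        K * powWeight ((p + 1) * α) r := by
  induction p with
  | zero => exact ⟨1, one_ne_zero, ENNReal.one_ne_top, fun r => by simp [lintegral_unique, volume_pi]⟩
  | succ p ih =>
    obtain ⟨K, hK0, hKt, hK⟩ := ih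
    have hp : 0 < ((p : ℝ) + 1) * α := by positivity
    refine ⟨K * ENNReal.ofReal (beta α ((p + 1) * α)), mul_ne_zero hK0 ?_,
      ENNReal.mul_ne_top hKt ENNReal.ofReal_ne_top, fun r => ?_⟩
    · simpa using beta_pos hα hp
    rw [lintegral_fin_succ _ (by fun_prop)]
    have : ∀ a : ℝ, ∫⁻ y : Fin p → ℝ, (∏ i, powWeight α ((Fin.cons a y : Fin (p + 1) → ℝ) i)) *
        powWeight α (r - ∑ i, (Fin.cons a y : Fin (p + 1) → ℝ) i) =
        K * (powWeight α a * powWeight ((p + 1) * α) (r - a)) := by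
      intro a
      simp only [Fin.prod_univ_succ, Fin.sum_univ_succ, Fin.cons_zero, Fin.cons_succ, mul_assoc,
        ← sub_sub]
      rw [lintegral_const_mul _ (by fun_prop), hK]
      ring
    simp_rw [this]
    rw [lintegral_const_mul _ (by fun_prop), lintegral_powWeight_mul_powWeight hα hp, mul_assoc]
    congr 3
    push_cast; ring

lemma lintegral_arrowCongr {ι κ : Type*} [Fintype ι] [Fintype κ] (e : ι ≃ κ)
    {f : (κ → ℝ) → ENNReal} (hf : Measurable f) :
    ∫⁻ x, f x = ∫⁻ y : ι → ℝ, f (fun k => y (e.symm k)) := by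
  rw [← (volume_measurePreserving_piCongrLeft (fun _ : κ => ℝ) e).lintegral_comp hf]
  refine lintegral_congr fun y => congrArg f ?_
  ext k
  obtain ⟨i, rfl⟩ := e.surjective k
  rw [MeasurableEquiv.coe_piCongrLeft, Equiv.piCongrLeft_apply_apply, e.symm_apply_apply]

lemma exists_lintegral_prod_powWeight {α : ℝ} (hα : 0 < α) (ι : Type*) [Fintype ι] :
    ∃ K : ENNReal, ∀ r : ℝ,
      ∫⁻ y : ι → ℝ, (∏ i, powWeight α (y i)) * powWeight α (r - ∑ i, y i) =
        K * powWeight ((Fintype.card ι + 1) * α) r := by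
  obtain ⟨K, -, -, hK⟩ := exists_lintegral_prod_powWeight_fin hα (Fintype.card ι)
  refine ⟨K, fun r => ?_⟩
  let e := Fintype.equivFin ι
  rw [← hK, lintegral_arrowCongr e.symm (by fun_prop)]
  refine lintegral_congr fun y => ?_
  rw [Equiv.symm_symm, e.prod_comp fun i => powWeight α (y i), e.sum_comp y]

/-- Liouville's extension of Dirichlet's integral. -/
lemma exists_lintegral_prod_powWeight_comp_sum {α : ℝ} (hα : 0 < α) (ι : Type*) [Fintype ι]
    [Nonempty ι] : ∃ K : ENNReal, ∀ F : ℝ → ENNReal, Measurable F →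
      ∫⁻ y : ι → ℝ, (∏ i, powWeight α (y i)) * F (∑ i, y i) =
        K * ∫⁻ s, F s * powWeight (Fintype.card ι * α) s := by
  obtain ⟨p, hp⟩ := Nat.exists_eq_add_of_lt (Fintype.card_pos (α := ι))
  obtain ⟨K, -, -, hK⟩ := exists_lintegral_prod_powWeight_fin hα p
  refine ⟨K, fun F hF => ?_⟩
  let e := Fintype.equivFinOfCardEq (hp.trans (by omega : 0 + p + 1 = p + 1))
  -- One coordinate is traded for the total s by translation; the others then form a Dirichlet
  -- integral with total s.
  have hsub : ∀ y : Fin p → ℝ, ∫⁻ a, powWeight α a * F (a + ∑ i, y i) =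
      ∫⁻ s, powWeight α (s - ∑ i, y i) * F s := fun y => by
    rw [← lintegral_add_right_eq_self (fun s => powWeight α (s - ∑ i, y i) * F s) (∑ i, y i)]
    simp
  calc ∫⁻ y : ι → ℝ, (∏ i, powWeight α (y i)) * F (∑ i, y i)
      = ∫⁻ x : Fin (p + 1) → ℝ, (∏ i, powWeight α (x i)) * F (∑ i, x i) := by
        rw [lintegral_arrowCongr e.symm (by fun_prop)]
        refine lintegral_congr fun y => ?_
        rw [Equiv.symm_symm, e.prod_comp fun i => powWeight α (y i), e.sum_comp y]
    _ = ∫⁻ a, ∫⁻ y : Fin p → ℝ, (∏ i, powWeight α (y i)) *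
          (powWeight α a * F (a + ∑ i, y i)) := by
        rw [lintegral_fin_succ _ (by fun_prop)]
        refine lintegral_congr fun a => lintegral_congr fun y => ?_
        simp only [Fin.prod_univ_succ, Fin.sum_univ_succ, Fin.cons_zero, Fin.cons_succ]
        ring
    _ = ∫⁻ y : Fin p → ℝ, (∏ i, powWeight α (y i)) *
          ∫⁻ a, powWeight α a * F (a + ∑ i, y i) := by
        rw [lintegral_lintegral_swap (by fun_prop)]
        refine lintegral_congr fun y => ?_
        rw [lintegral_const_mul _ (by fun_prop)]
    _ = ∫⁻ y : Fin p → ℝ, ∫⁻ s,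
          F s * ((∏ i, powWeight α (y i)) * powWeight α (s - ∑ i, y i)) := by
        refine lintegral_congr fun y => ?_
        rw [hsub, ← lintegral_const_mul _ (by fun_prop)]
        refine lintegral_congr fun s => by ring
    _ = ∫⁻ s, F s * (K * powWeight ((p + 1) * α) s) := by
        rw [lintegral_lintegral_swap (by fun_prop)]
        refine lintegral_congr fun s => ?_
        rw [lintegral_const_mul _ (by fun_prop), hK]
    _ = K * ∫⁻ s, F s * powWeight (Fintype.card ι * α) s := by
        rw [← lintegral_const_mul _ (by fun_prop)]
        refine lintegral_congr fun s => ?_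
        rw [hp]
        push_cast
        rw [zero_add]
        ring

/-! ### Aggregation: the law of a coalition's weight on a slice. -/

/-- The unnormalized symmetric Dirichlet distribution on the simplex `∑ zᵢ = r` in `ℝ ^ (m + 1)`,
as a measure in the first `m` coordinates. -/
def scaledDirichlet (m : ℕ) (α r : ℝ) : Measure (Fin m → ℝ) :=
  volume.withDensity fun z => (∏ i, powWeight α (z i)) * powWeight α (r - ∑ i, z i)

lemma lintegral_scaledDirichlet (m : ℕ) (α r : ℝ) {f : (Fin m → ℝ) → ENNReal}
    (hf : Measurable f) : ∫⁻ z, f z ∂(scaledDirichlet m α r) =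
      ∫⁻ z, (∏ i, powWeight α (z i)) * powWeight α (r - ∑ i, z i) * f z := by
  rw [scaledDirichlet, lintegral_withDensity_eq_lintegral_mul _ (by fun_prop) hf]
  rfl

lemma scaledDirichlet_univ (m : ℕ) {α r : ℝ} (hα : 0 < α) (hr : 0 < r) :
    scaledDirichlet m α r Set.univ ≠ 0 ∧ scaledDirichlet m α r Set.univ ≠ ⊤ := by
  obtain ⟨K, hK0, hKt, hK⟩ := exists_lintegral_prod_powWeight_fin hα m
  rw [scaledDirichlet, withDensity_apply _ MeasurableSet.univ, Measure.restrict_univ, hK]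
  exact ⟨mul_ne_zero hK0 (powWeight_ne_zero hr), ENNReal.mul_ne_top hKt (powWeight_ne_top _ _)⟩

/-- Reflecting s to 1 - s in the Beta integral with r = 1 exchanges p and q; the common constant is
positive and finite, hence cancels. -/
lemma lintegral_betaMeasure_one_sub {p q : ℝ} (hp : 0 < p) (hq : 0 < q) {F : ℝ → ENNReal}
    (hF : Measurable F) :
    ∫⁻ t, F (1 - t) ∂(betaMeasure p q) = ∫⁻ t, F t ∂(betaMeasure q p) := by
  have h1 := lintegral_mul_powWeight_mul_powWeight hp hq one_pos
    (F := fun t => F (1 - t)) (by fun_prop)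
  have h2 := lintegral_mul_powWeight_mul_powWeight hq hp one_pos hF
  rw [← lintegral_sub_left_eq_self _ 1] at h2
  have hb : beta q p = beta p q := by rw [beta, beta, mul_comm, add_comm]
  simp only [sub_sub_cancel, one_mul] at h1 h2
  simp only [mul_comm (powWeight q _), hb, add_comm q] at h2
  have h := h1.symm.trans h2
  rwa [ENNReal.mul_right_inj] at h
  · exact mul_ne_zero (by simpa using beta_pos hp hq) (powWeight_ne_zero one_pos)
  · exact ENNReal.mul_ne_top ENNReal.ofReal_ne_top (powWeight_ne_top _ _)

/-- Here C avoids the dependent last coordinate. Integrating out the free coordinates outside C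
gives a power of r minus the weight of C; Liouville's formula then collapses C to its total, leaving
a Beta integral. The dependent coordinate accounts for the + 1 in m + 1 - |C|. -/
lemma exists_lintegral_comp_sum_scaledDirichlet {m : ℕ} {α r : ℝ} (hα : 0 < α) (hr : 0 < r)
    {C : Finset (Fin m)} (hC : C.Nonempty) :
    ∃ K : ENNReal, ∀ F : ℝ → ENNReal, Measurable F →
      ∫⁻ z, F (∑ i ∈ C, z i) ∂(scaledDirichlet m α r) =
        K * ∫⁻ t, F (r * t) ∂(betaMeasure (C.card * α) ((m + 1 - C.card) * α)) := by
  have hCα : 0 < (C.card : ℝ) * α := mul_pos (by exact_mod_cast hC.card_pos) hα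
  have hle : (C.card : ℝ) ≤ m := by exact_mod_cast (C.card_le_univ.trans_eq (Fintype.card_fin m))
  have hDα : 0 < ((m : ℝ) + 1 - C.card) * α := mul_pos (by linarith) hα
  have hcard : ((Fintype.card {i // i ∉ C} : ℝ) + 1) = m + 1 - C.card := by
    have : Fintype.card {i // i ∉ C} + C.card = m := by
      have h := Fintype.card_subtype_compl (· ∈ C)
      rw [Fintype.card_coe, Fintype.card_fin] at h
      have : C.card ≤ m := by exact_mod_cast hle
      omega
    have : (Fintype.card {i // i ∉ C} : ℝ) + C.card = m := by exact_mod_cast this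
    linarith
  have : Nonempty {i // i ∈ C} := hC.to_subtype
  obtain ⟨K₁, hK₁⟩ := exists_lintegral_prod_powWeight_comp_sum hα {i // i ∈ C}
  obtain ⟨K₂, hK₂⟩ := exists_lintegral_prod_powWeight hα {i // i ∉ C}
  rw [hcard] at hK₂
  rw [Fintype.card_coe] at hK₁
  refine ⟨K₁ * K₂ * (ENNReal.ofReal (beta (C.card * α) ((m + 1 - C.card) * α)) *
    powWeight (C.card * α + (m + 1 - C.card) * α) r), fun F hF => ?_⟩
  let H : ({i // i ∈ C} → ℝ) × ({i // i ∉ C} → ℝ) → ENNReal := fun w =>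
    (∏ i, powWeight α (w.1 i)) * F (∑ i, w.1 i) *
      ((∏ i, powWeight α (w.2 i)) * powWeight α (r - ∑ i, w.1 i - ∑ i, w.2 i))
  have hH : Measurable H := by fun_prop
  calc ∫⁻ z, F (∑ i ∈ C, z i) ∂(scaledDirichlet m α r)
      = ∫⁻ z, H (MeasurableEquiv.piEquivPiSubtypeProd (fun _ : Fin m => ℝ) (· ∈ C) z) := by
        rw [lintegral_scaledDirichlet _ _ _ (by fun_prop)]
        refine lintegral_congr fun z => ?_
        have e1 : (∏ i : {i // i ∈ C}, powWeight α (z i)) *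
            ∏ i : {i // i ∉ C}, powWeight α (z i) = ∏ i, powWeight α (z i) := by
          convert! Fintype.prod_subtype_mul_prod_subtype (· ∈ C) fun i => powWeight α (z i)
        have e2 : ∑ i : {i // i ∈ C}, z i + ∑ i : {i // i ∉ C}, z i = ∑ i, z i := by
          convert! Fintype.sum_subtype_add_sum_subtype (· ∈ C) z
        have e3 : ∑ i ∈ C, z i = ∑ i : {i // i ∈ C}, z i := (Finset.sum_coe_sort C z).symm
        rw [← e1, ← e2, e3, ← sub_sub]
        change _ = (∏ i : {i // i ∈ C}, powWeight α (z i)) * F (∑ i : {i // i ∈ C}, z i) *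
          ((∏ i : {i // i ∉ C}, powWeight α (z i)) *
            powWeight α (r - ∑ i : {i // i ∈ C}, z i - ∑ i : {i // i ∉ C}, z i))
        ring
    _ = ∫⁻ w, H w ∂(volume.prod volume) := by
        rw [← Measure.volume_eq_prod]
        convert! (volume_preserving_piEquivPiSubtypeProd
          (fun _ : Fin m => ℝ) (· ∈ C)).lintegral_comp hH
    _ = ∫⁻ x : {i // i ∈ C} → ℝ, (∏ i, powWeight α (x i)) *
          (F (∑ i, x i) * (K₂ * powWeight ((m + 1 - C.card) * α) (r - ∑ i, x i))) := by
        rw [lintegral_prod _ hH.aemeasurable]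
        refine lintegral_congr fun x => ?_
        simp only [H]
        rw [lintegral_const_mul _ (by fun_prop), hK₂, mul_assoc]
    _ = K₁ * ∫⁻ s, K₂ * (F s * (powWeight (C.card * α) s *
          powWeight ((m + 1 - C.card) * α) (r - s))) := by
        rw [hK₁ (fun s => F s * (K₂ * powWeight ((m + 1 - C.card) * α) (r - s))) (by fun_prop)]
        congr 1
        refine lintegral_congr fun s => by ring
    _ = _ := by
        rw [lintegral_const_mul _ (by fun_prop),
          lintegral_mul_powWeight_mul_powWeight hCα hDα hr hF]
        ring

/-- Under the Dirichlet distribution on the simplex `∑ zᵢ = r`, the total weight of a nonempty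
proper coalition, divided by `r`, has a Beta distribution. -/
lemma lintegral_comp_sum_snoc_scaledDirichlet {m : ℕ} {α r : ℝ} (hα : 0 < α) (hr : 0 < r)
    {C : Finset (Fin (m + 1))} (hC : C.Nonempty) (hC' : C ≠ Finset.univ) {F : ℝ → ENNReal}
    (hF : Measurable F) :
    ∫⁻ z, F (∑ i ∈ C, (Fin.snoc z (r - ∑ i, z i) : Fin (m + 1) → ℝ) i) ∂(scaledDirichlet m α r) =
      scaledDirichlet m α r Set.univ *
        ∫⁻ t, F (r * t) ∂(betaMeasure (C.card * α) ((m + 1 - C.card) * α)) := by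
  have hCα : 0 < (C.card : ℝ) * α := mul_pos (by exact_mod_cast hC.card_pos) hα
  have hlt : (C.card : ℝ) < m + 1 := by
    exact_mod_cast (Finset.card_lt_univ_of_notMem (not_forall.1
      fun h => hC' (Finset.eq_univ_iff_forall.2 h)).choose_spec).trans_eq (Fintype.card_fin _)
  have hDα : 0 < ((m : ℝ) + 1 - C.card) * α := mul_pos (by linarith) hα
  have key : ∀ {D : Finset (Fin (m + 1))}, D.Nonempty → Fin.last m ∉ D →
      ∃ K : ENNReal, ∀ G : ℝ → ENNReal, Measurable G →
        ∫⁻ z, G (∑ i ∈ D, (Fin.snoc z (r - ∑ i, z i) : Fin (m + 1) → ℝ) i)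
            ∂(scaledDirichlet m α r) =
          K * ∫⁻ t, G (r * t) ∂(betaMeasure (D.card * α) ((m + 1 - D.card) * α)) := by
    intro D hD hlast
    obtain ⟨E, rfl⟩ : ∃ E : Finset (Fin m), D = E.map Fin.castSuccEmb := by
      refine ⟨Finset.univ.filter fun i => i.castSucc ∈ D, ?_⟩
      ext i
      refine Fin.lastCases ?_ (fun j => ?_) i
      · simp [hlast]
      · simp
    obtain ⟨K, hK⟩ := exists_lintegral_comp_sum_scaledDirichlet hα hr (Finset.map_nonempty.1 hD)
    refine ⟨K, fun G hG => ?_⟩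
    simpa using hK G hG
  have main : ∃ K : ENNReal, ∀ G : ℝ → ENNReal, Measurable G →
      ∫⁻ z, G (∑ i ∈ C, (Fin.snoc z (r - ∑ i, z i) : Fin (m + 1) → ℝ) i)
          ∂(scaledDirichlet m α r) =
        K * ∫⁻ t, G (r * t) ∂(betaMeasure (C.card * α) ((m + 1 - C.card) * α)) := by
    -- If C contains the dependent coordinate, its complement does not; the weight of C is r minus
    -- that of the complement, and Beta laws reflect accordingly.
    by_cases hl : Fin.last m ∈ C
    · obtain ⟨K, hK⟩ := key (D := Cᶜ) ((Finset.compl_ne_univ_iff_nonempty Cᶜ).1 (by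
        rw [compl_compl]; exact hC')) (by simpa using hl)
      have hcard : ((Cᶜ.card : ℕ) : ℝ) = m + 1 - C.card := by
        rw [eq_sub_iff_add_eq]
        exact_mod_cast (Finset.card_compl_add_card C).trans (Fintype.card_fin _)
      rw [hcard, sub_sub_cancel] at hK
      refine ⟨K, fun G hG => ?_⟩
      rw [← lintegral_betaMeasure_one_sub hDα hCα (F := fun t => G (r * t)) (by fun_prop)]
      have := hK (fun s => G (r - s)) (by fun_prop)
      simp only [mul_sub, mul_one]
      rw [← this]
      refine lintegral_congr fun z => congrArg G ?_
      rw [eq_sub_iff_add_eq, Finset.sum_add_sum_compl, Fin.sum_univ_castSucc]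
      simp
    · exact key hC hl
  obtain ⟨K, hK⟩ := main
  have := isProbabilityMeasureBeta hCα hDα
  -- Testing on the constant 1 identifies K as the total mass, so no explicit Gamma quotient is
  -- needed.
  have h1 := hK (fun _ => 1) measurable_const
  simp only [lintegral_const, one_mul, measure_univ, mul_one] at h1
  rw [h1, hK F hF]

/-! ### The Beta distribution function. -/

lemma measurable_betaPDF (p q : ℝ) : Measurable (betaPDF p q) :=
  (measurable_betaPDFReal p q).ennreal_ofReal

lemma incompleteBeta_eq {p q : ℝ} (hp : 0 < p) (hq : 0 < q) (h : ℝ) :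
    incompleteBeta h p q = beta p q * (betaMeasure p q).real (Set.Iic h) := by
  have hb := beta_pos hp hq
  set H : ℝ := max 0 (min h 1) with hH
  have hH0 : 0 ≤ H := le_max_left _ _
  have hH1 : H ≤ 1 := max_le zero_le_one (min_le_right _ _)
  have hnn : ∀ t ∈ Set.Ioc 0 H, 0 ≤ t ^ (p - 1) * (1 - t) ^ (q - 1) := fun t ht =>
    mul_nonneg (Real.rpow_nonneg ht.1.le _) (Real.rpow_nonneg (by linarith [ht.2]) _)
  rw [incompleteBeta, intervalIntegral.integral_of_le hH0,
    integral_eq_lintegral_of_nonneg_ae (ae_restrict_of_forall_mem measurableSet_Ioc hnn)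
      (Measurable.aestronglyMeasurable (by fun_prop)),
    Measure.real, betaMeasure, withDensity_apply _ measurableSet_Iic,
    ← ENNReal.toReal_ofReal_mul _ _ hb.le,
    ← lintegral_const_mul _ (measurable_betaPDF p q), ← lintegral_indicator measurableSet_Ioc,
    ← lintegral_indicator measurableSet_Iic]
  congr 1
  refine lintegral_congr_ae ?_
  -- At t = 1 with q = 1 the integrand is 1, as 0 ^ 0 = 1, while `betaPDF` vanishes there; this null
  -- point is discarded.
  filter_upwards [compl_mem_ae_iff.2 (measure_singleton (1 : ℝ))] with t ht
  have ht1 : t ≠ 1 := ht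
  by_cases hI : 0 < t ∧ t < 1
  · have hiff : t ∈ Set.Ioc 0 H ↔ t ∈ Set.Iic h := by
      simp [hH, hI.1, hI.1.not_ge, hI.2.le]
    by_cases hth : t ∈ Set.Iic h
    · rw [Set.indicator_of_mem (hiff.2 hth), Set.indicator_of_mem hth,
        betaPDF_of_pos_lt_one hI.1 hI.2, ← ENNReal.ofReal_mul hb.le]
      congr 1
      field_simp
    · rw [Set.indicator_of_notMem (mt hiff.1 hth), Set.indicator_of_notMem hth]
  · have h1 : t ∉ Set.Ioc 0 H := fun hm => hI ⟨hm.1, lt_of_le_of_ne (hm.2.trans hH1) ht1⟩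
    simp [Set.indicator, h1, betaPDF_eq, hI]

lemma betaFunction_eq {p q : ℝ} (hp : 0 < p) (hq : 0 < q) : betaFunction p q = beta p q := by
  have h := incompleteBeta_eq hp hq 1
  have := isProbabilityMeasureBeta hp hq
  have h1 : (betaMeasure p q).real (Set.Iic 1) = 1 := by
    have h0 : betaMeasure p q (Set.Ioi 1) = 0 := by
      rw [betaMeasure, withDensity_apply _ measurableSet_Ioi]
      exact setLIntegral_eq_zero measurableSet_Ioi
        fun x hx => betaPDF_eq_zero_of_one_le (le_of_lt hx)
    rw [← Set.compl_Ioi, probReal_compl_eq_one_sub measurableSet_Ioi, Measure.real, h0]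
    simp
  rw [h1, mul_one] at h
  rw [← h, incompleteBeta, betaFunction]
  simp

lemma betaCdf_eq_measureReal_Iic {m k : ℕ} {α : ℝ} (hα : 0 < α) (hk : 0 < k) (hkm : k ≤ m)
    (h : ℝ) : betaCdf (m + 2) h k α =
      (betaMeasure (k * α) ((m + 1 - k) * α)).real (Set.Iic h) := by
  have hp : 0 < (k : ℝ) * α := by positivity
  have hkm' : (k : ℝ) ≤ m := by exact_mod_cast hkm
  have hq : 0 < ((m : ℝ) + 1 - k) * α := mul_pos (by linarith) hα
  have hcast : (((m + 2 : ℕ) : ℝ) - 1 - k) * α = ((m : ℝ) + 1 - k) * α := by push_cast; ring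
  rw [betaCdf, hcast, incompleteBeta_eq hp hq, betaFunction_eq hp hq,
    mul_div_cancel_left₀ _ (beta_pos hp hq).ne']

/-- The Beta law has no atom at (θ - s) / r, the only point where membership in U is undetermined.
-/
lemma measureReal_betaMeasure_add_mul_mem {p q : ℝ} (hp : 0 < p) (hq : 0 < q) {θ s r : ℝ}
    (hr : 0 < r) {U : Set ℝ} (hU : Set.Ioi θ ⊆ U) (hU' : U ⊆ Set.Ici θ) :
    (betaMeasure p q).real {t | s + r * t ∈ U} =
      1 - (betaMeasure p q).real (Set.Iic ((θ - s) / r)) := by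
  have := isProbabilityMeasureBeta hp hq
  rw [← probReal_compl_eq_one_sub measurableSet_Iic, Set.compl_Iic]
  refine measureReal_congr ?_
  have hnull : betaMeasure p q {(θ - s) / r} = 0 :=
    withDensity_absolutelyContinuous _ _ (measure_singleton _)
  filter_upwards [compl_mem_ae_iff.2 hnull] with t ht
  have ht : t ≠ (θ - s) / r := ht
  refine propext ⟨fun h => ?_, fun h => hU ?_⟩
  · have h1 : θ ≤ s + r * t := hU' h
    refine lt_of_le_of_ne ?_ ht.symm
    rw [div_le_iff₀ hr]; linarith
  · have h1 : (θ - s) / r < t := h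
    rw [div_lt_iff₀ hr] at h1
    change θ < s + r * t
    linarith

/-! ### The Dirichlet density on the slice X₁ = c. -/

lemma simplexPoint_cons {m : ℕ} (c : ℝ) (z : Fin m → ℝ) :
    simplexPoint (Fin.cons c z : Fin (m + 1) → ℝ) =
      Fin.cons c (Fin.snoc z (1 - c - ∑ i, z i) : Fin (m + 1) → ℝ) := by
  rw [simplexPoint, Fin.cons_snoc_eq_snoc_cons, Fin.sum_cons, sub_sub]

lemma sum_simplexPoint {d : ℕ} (y : Fin d → ℝ) : ∑ i, simplexPoint y i = 1 := by
  simp [simplexPoint, Fin.sum_univ_castSucc]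

lemma measurable_simplexPoint {d : ℕ} : Measurable (simplexPoint (d := d)) := by
  refine measurable_pi_lambda _ fun i => ?_
  refine Fin.lastCases ?_ (fun j => ?_) i
  · simp only [simplexPoint, Fin.snoc_last]; fun_prop
  · simp only [simplexPoint, Fin.snoc_castSucc]; fun_prop

lemma measurable_dirichletDensity {n : ℕ} (a : Fin n → ℝ) : Measurable (dirichletDensity a) := by
  refine Measurable.ite ?_ (by fun_prop) measurable_const
  simp only [Set.ofPred_forall]
  exact MeasurableSet.iInter fun i => measurableSet_lt measurable_const (measurable_pi_apply i)

lemma dirichletDensity_nonneg {n : ℕ} {a : Fin n → ℝ} (ha : ∀ i, 0 < a i) (x : Fin n → ℝ) :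
    0 ≤ dirichletDensity a x := by
  unfold dirichletDensity
  split_ifs with h
  · refine mul_nonneg (one_div_nonneg.2 (div_nonneg (Finset.prod_nonneg fun i _ =>
      (Real.Gamma_pos_of_pos (ha i)).le) (Real.Gamma_nonneg_of_nonneg
        (Finset.sum_nonneg fun i _ => (ha i).le))))
      (Finset.prod_nonneg fun i _ => Real.rpow_nonneg (h i).le _)
  · exact le_rfl

lemma exists_dirichletDensity_simplexPoint_cons (m : ℕ) {α c : ℝ} (hα : 0 < α) (hc : 0 < c) :
    ∃ κ : ℝ, κ ≠ 0 ∧ ∀ z : Fin m → ℝ,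
      dirichletDensity (fun _ => α) (simplexPoint (Fin.cons c z : Fin (m + 1) → ℝ)) =
        κ * ((∏ i, powWeight α (z i)) * powWeight α (1 - c - ∑ i, z i)).toReal := by
  have hG : (∏ _i : Fin (m + 2), Real.Gamma α) / Real.Gamma (∑ _i : Fin (m + 2), α) ≠ 0 := by
    refine div_ne_zero (Finset.prod_ne_zero_iff.2 fun i _ => (Real.Gamma_pos_of_pos hα).ne')
      (Real.Gamma_pos_of_pos ?_).ne'
    exact Finset.sum_pos (fun _ _ => hα) Finset.univ_nonempty
  refine ⟨1 / ((∏ _i : Fin (m + 2), Real.Gamma α) / Real.Gamma (∑ _i : Fin (m + 2), α)) *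
    c ^ (α - 1), mul_ne_zero (one_div_ne_zero hG) (Real.rpow_pos_of_pos hc _).ne', fun z => ?_⟩
  rw [dirichletDensity, simplexPoint_cons]
  simp only [Fin.prod_univ_succ (n := m + 1), Fin.cons_zero, Fin.cons_succ,
    Fin.prod_univ_castSucc (n := m), Fin.snoc_castSucc, Fin.snoc_last]
  split_ifs with h
  · have h1 : ∀ i, 0 < z i := fun i => by simpa using h i.castSucc.succ
    have h2 : 0 < 1 - c - ∑ i, z i := by simpa using h (Fin.last m).succ
    have h3 : ∀ i, (powWeight α (z i)).toReal = z i ^ (α - 1) := fun i => by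
      simp [powWeight, h1, Real.rpow_nonneg (h1 i).le]
    have h4 : (powWeight α (1 - c - ∑ i, z i)).toReal = (1 - c - ∑ i, z i) ^ (α - 1) := by
      simp only [powWeight, h2, if_true]
      exact ENNReal.toReal_ofReal (Real.rpow_nonneg h2.le _)
    rw [ENNReal.toReal_mul, ENNReal.toReal_prod, h4]
    simp only [h3]
    ring
  · suffices hz : (∏ i, powWeight α (z i)) * powWeight α (1 - c - ∑ i, z i) = 0 by simp [hz]
    by_contra hne
    obtain ⟨h1, h2⟩ := mul_ne_zero_iff.1 hne
    refine h fun i => Fin.cases (by simpa using hc) (fun j => ?_) i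
    refine Fin.lastCases ?_ (fun k => ?_) j
    · rw [Fin.cons_succ, Fin.snoc_last]
      exact not_le.1 fun hle => h2 (powWeight_of_nonpos hle)
    · rw [Fin.cons_succ, Fin.snoc_castSucc]
      exact not_le.1 fun hle =>
        (Finset.prod_ne_zero_iff.1 h1 k (Finset.mem_univ k)) (powWeight_of_nonpos hle)

/-- The Gamma constant and the factor c ^ (α - 1) do not depend on z and cancel between numerator
and denominator. -/
lemma dirichletCondMean_eq_integral_div (m : ℕ) {α c : ℝ} (hα : 0 < α) (hc : 0 < c)
    (g : (Fin (m + 2) → ℝ) → ℝ) :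
    dirichletCondMean m (fun _ => α) g c =
      (∫ z, g (simplexPoint (Fin.cons c z : Fin (m + 1) → ℝ)) ∂(scaledDirichlet m α (1 - c))) /
        (scaledDirichlet m α (1 - c)).real Set.univ := by
  obtain ⟨κ, hκ, hD⟩ := exists_dirichletDensity_simplexPoint_cons m hα hc
  have key : ∀ f : (Fin m → ℝ) → ℝ,
      ∫ z, f z * dirichletDensity (fun _ => α) (simplexPoint (Fin.cons c z : Fin (m + 1) → ℝ)) =
        κ * ∫ z, f z ∂(scaledDirichlet m α (1 - c)) := by
    intro f
    rw [scaledDirichlet, integral_withDensity_eq_integral_toReal_smul (by fun_prop)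
      (Filter.Eventually.of_forall fun z => ENNReal.mul_lt_top
        (ENNReal.prod_lt_top fun i _ => (powWeight_ne_top _ _).lt_top)
        (powWeight_ne_top _ _).lt_top), ← integral_const_mul]
    refine integral_congr_ae (Filter.Eventually.of_forall fun z => ?_)
    simp only [hD, smul_eq_mul]
    ring
  have h1 := key fun _ => 1
  simp only [one_mul, integral_const, smul_eq_mul, mul_one] at h1
  rw [dirichletCondMean, key, h1, mul_div_mul_left _ _ hκ]

/-! ### Quota rules and the Banzhaf index. -/

/-- The decision function for which a coalition is winning when its share of the total weight
belongs to `U`. -/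
def shareRule {n : ℕ} (U : Set ℝ) (w : Fin n → ℝ) (C : Finset (Fin n)) : ℝ :=
  U.indicator 1 ((∑ i ∈ C, w i) / ∑ i, w i)

lemma quotaRule_eq_shareRule {n : ℕ} (θ : ℝ) :
    quotaRule (n := n) θ = shareRule (Set.Ici θ) := by
  ext w C
  simp [quotaRule, shareRule, Set.indicator]

lemma strictQuotaRule_eq_shareRule {n : ℕ} (θ : ℝ) :
    strictQuotaRule (n := n) θ = shareRule (Set.Ioi θ) := by
  ext w C
  simp [strictQuotaRule, shareRule, Set.indicator]

lemma shareRule_mem_Icc {n : ℕ} (U : Set ℝ) (w : Fin n → ℝ) (C : Finset (Fin n)) :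
    shareRule U w C ∈ Set.Icc (0 : ℝ) 1 :=
  ⟨Set.indicator_nonneg (fun _ _ => zero_le_one) _, Set.indicator_le_self' (by simp) _⟩

lemma measurable_shareRule {n : ℕ} {U : Set ℝ} (hU : MeasurableSet U) (C : Finset (Fin n)) :
    Measurable fun w : Fin n → ℝ => shareRule U w C :=
  (measurable_one.indicator hU).comp (by fun_prop)

lemma measurable_banzhafIndex_shareRule {n : ℕ} {U : Set ℝ} (hU : MeasurableSet U) (i : Fin n) :
    Measurable fun w : Fin n → ℝ => banzhafIndex (shareRule U w) i :=
  (Finset.measurable_sum _ fun _ _ =>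
    (measurable_shareRule hU _).sub (measurable_shareRule hU _)).const_mul _

lemma abs_banzhafIndex_shareRule_le {n : ℕ} (U : Set ℝ) (w : Fin n → ℝ) (i : Fin n) :
    |banzhafIndex (shareRule U w) i| ≤ 1 := by
  have hn : n ≠ 0 := fun h => (h ▸ i).elim0
  rw [banzhafIndex, abs_mul, abs_of_pos (by positivity : (0 : ℝ) < 1 / 2 ^ (n - 1)), one_div,
    inv_mul_le_iff₀ (by positivity), mul_one]
  refine (Finset.abs_sum_le_sum_abs _ _).trans ?_
  have : ∀ C ∈ (Finset.univ.erase i).powerset,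
      |shareRule U w (insert i C) - shareRule U w C| ≤ 1 := fun C _ => by
    have h1 := shareRule_mem_Icc U w (insert i C)
    have h2 := shareRule_mem_Icc U w C
    rw [abs_le]
    constructor <;> linarith [h1.1, h1.2, h2.1, h2.2]
  refine (Finset.sum_le_card_nsmul _ _ 1 this).trans ?_
  simp [Finset.card_powerset, Finset.card_erase_of_mem]

lemma banzhafIndex_zero {n : ℕ} (f : Finset (Fin (n + 1)) → ℝ) :
    banzhafIndex f 0 = 1 / 2 ^ n * ∑ C ∈ (Finset.univ : Finset (Fin n)).powerset,
      (f (insert 0 (C.map (Fin.succEmb n))) - f (C.map (Fin.succEmb n))) := by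
  have h : (Finset.univ.erase (0 : Fin (n + 1))) = Finset.univ.map (Fin.succEmb n) := by
    ext i
    refine Fin.cases ?_ (fun j => ?_) i <;> simp
  rw [banzhafIndex, h, Nat.add_sub_cancel]
  congr 1
  symm
  refine Finset.sum_nbij (fun C => C.map (Fin.succEmb n)) ?_ ?_ ?_ fun _ _ => rfl
  · intro C _
    simp only [Finset.mem_powerset]
    exact Finset.map_subset_map.2 (Finset.subset_univ C)
  · exact fun C _ D _ hCD => Finset.map_injective _ hCD
  · intro D hD
    obtain ⟨C, -, rfl⟩ := Finset.subset_map_iff.1 (Finset.mem_powerset.1 hD)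
    exact ⟨C, by simp, rfl⟩

/-! ### Swing probabilities and the conditional mean. -/

/-- The probability, under the Dirichlet distribution on the simplex `∑ zᵢ = r`, that the weight of
the coalition `C` increased by `s` belongs to `U`. -/
def coalitionProb (m : ℕ) (α r : ℝ) (U : Set ℝ) (s : ℝ) (C : Finset (Fin (m + 1))) : ℝ :=
  (scaledDirichlet m α r).real
      {z | s + ∑ i ∈ C, (Fin.snoc z (r - ∑ i, z i) : Fin (m + 1) → ℝ) i ∈ U} /
    (scaledDirichlet m α r).real Set.univ

lemma measureReal_scaledDirichlet_univ_ne_zero (m : ℕ) {α r : ℝ} (hα : 0 < α) (hr : 0 < r) :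
    (scaledDirichlet m α r).real Set.univ ≠ 0 :=
  ENNReal.toReal_ne_zero.2 (scaledDirichlet_univ m hα hr)

lemma div_measureReal_univ_of_const (m : ℕ) {α r : ℝ} (hα : 0 < α) (hr : 0 < r) (U : Set ℝ)
    (s : ℝ) : (scaledDirichlet m α r).real {_z | s ∈ U} / (scaledDirichlet m α r).real Set.univ =
      U.indicator 1 s := by
  by_cases hs : s ∈ U
  · simp [hs, div_self (measureReal_scaledDirichlet_univ_ne_zero m hα hr)]
  · simp [hs]

lemma coalitionProb_empty (m : ℕ) {α r : ℝ} (hα : 0 < α) (hr : 0 < r) (U : Set ℝ) (s : ℝ) :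
    coalitionProb m α r U s ∅ = U.indicator 1 s := by
  simpa [coalitionProb] using div_measureReal_univ_of_const m hα hr U s

lemma coalitionProb_univ (m : ℕ) {α r : ℝ} (hα : 0 < α) (hr : 0 < r) (U : Set ℝ) (s : ℝ) :
    coalitionProb m α r U s Finset.univ = U.indicator 1 (s + r) := by
  simpa [coalitionProb, Fin.sum_univ_castSucc] using
    div_measureReal_univ_of_const m hα hr U (s + r)

lemma coalitionProb_eq_one_sub_betaCdf {m : ℕ} {α r θ : ℝ} (hα : 0 < α) (hr : 0 < r) {U : Set ℝ}
    (hUm : MeasurableSet U) (hU : Set.Ioi θ ⊆ U) (hU' : U ⊆ Set.Ici θ) (s : ℝ)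
    {C : Finset (Fin (m + 1))} (hC : C.Nonempty) (hC' : C ≠ Finset.univ) :
    coalitionProb m α r U s C = 1 - betaCdf (m + 2) ((θ - s) / r) C.card α := by
  have hlt : C.card < m + 1 :=
    (Finset.card_lt_univ_of_notMem (not_forall.1
      fun h => hC' (Finset.eq_univ_iff_forall.2 h)).choose_spec).trans_eq (Fintype.card_fin _)
  have hlt' : (C.card : ℝ) < m + 1 := by exact_mod_cast hlt
  have hp : 0 < (C.card : ℝ) * α := mul_pos (by exact_mod_cast hC.card_pos) hα
  have hq : 0 < ((m : ℝ) + 1 - C.card) * α := mul_pos (by linarith) hα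
  have hsnoc : Measurable fun z : Fin m → ℝ =>
      s + ∑ i ∈ C, (Fin.snoc z (r - ∑ i, z i) : Fin (m + 1) → ℝ) i := by
    refine measurable_const.add (Finset.measurable_sum _ fun i _ => ?_)
    refine Fin.lastCases ?_ (fun j => ?_) i
    · simp only [Fin.snoc_last]; fun_prop
    · simp only [Fin.snoc_castSucc]; fun_prop
  have key := lintegral_comp_sum_snoc_scaledDirichlet hα hr hC hC'
    (F := fun t => U.indicator 1 (s + t))
    ((measurable_one.indicator hUm).comp (by fun_prop))
  have e1 : ∫⁻ z, U.indicator 1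
        (s + ∑ i ∈ C, (Fin.snoc z (r - ∑ i, z i) : Fin (m + 1) → ℝ) i)
        ∂(scaledDirichlet m α r) = scaledDirichlet m α r
      {z | s + ∑ i ∈ C, (Fin.snoc z (r - ∑ i, z i) : Fin (m + 1) → ℝ) i ∈ U} :=
    lintegral_indicator_one (hsnoc hUm)
  have e2 : ∫⁻ t, U.indicator 1 (s + r * t)
        ∂(betaMeasure (C.card * α) ((m + 1 - C.card) * α)) =
      betaMeasure (C.card * α) ((m + 1 - C.card) * α) {t | s + r * t ∈ U} :=
    lintegral_indicator_one ((by fun_prop : Measurable fun t : ℝ => s + r * t) hUm)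
  rw [coalitionProb, Measure.real, ← e1, key, e2, ENNReal.toReal_mul]
  change (scaledDirichlet m α r).real _ * (betaMeasure _ _).real _ / _ = _
  rw [mul_div_cancel_left₀ _ (measureReal_scaledDirichlet_univ_ne_zero m hα hr),
    measureReal_betaMeasure_add_mul_mem hp hq hr hU hU',
    betaCdf_eq_measureReal_Iic hα hC.card_pos (by omega)]

lemma shareRule_simplexPoint {d : ℕ} (U : Set ℝ) (y : Fin d → ℝ) (C : Finset (Fin (d + 1))) :
    shareRule U (simplexPoint y) C = U.indicator 1 (∑ i ∈ C, simplexPoint y i) := by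
  rw [shareRule, sum_simplexPoint, div_one]

lemma dirichletCondMean_banzhafIndex (m : ℕ) {α c : ℝ} (hα : 0 < α) (hc : 0 < c) (hc1 : c < 1)
    {U : Set ℝ} (hUm : MeasurableSet U) :
    dirichletCondMean m (fun _ => α) (fun x => banzhafIndex (shareRule U x) 0) c =
      1 / 2 ^ (m + 1) * ∑ C ∈ (Finset.univ : Finset (Fin (m + 1))).powerset,
        (coalitionProb m α (1 - c) U c C - coalitionProb m α (1 - c) U 0 C) := by
  have hr : 0 < 1 - c := sub_pos.2 hc1
  have hfin : IsFiniteMeasure (scaledDirichlet m α (1 - c)) :=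
    ⟨(scaledDirichlet_univ m hα hr).2.lt_top⟩
  have hT : Measurable fun z : Fin m → ℝ => simplexPoint (Fin.cons c z : Fin (m + 1) → ℝ) :=
    measurable_simplexPoint.comp (measurable_fin_cons.comp (by fun_prop :
      Measurable fun z : Fin m → ℝ => (c, z)))
  have hint : ∀ C : Finset (Fin (m + 2)), Integrable (fun z : Fin m → ℝ =>
      shareRule U (simplexPoint (Fin.cons c z : Fin (m + 1) → ℝ)) C)
      (scaledDirichlet m α (1 - c)) := fun C => by
    refine Integrable.of_bound ((measurable_shareRule hUm C).comp hT).aestronglyMeasurable 1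
      (Filter.Eventually.of_forall fun z => ?_)
    have h := shareRule_mem_Icc U (simplexPoint (Fin.cons c z : Fin (m + 1) → ℝ)) C
    rw [Real.norm_of_nonneg h.1]
    exact h.2
  have hint₂ : ∀ C D : Finset (Fin (m + 2)), Integrable (fun z : Fin m → ℝ =>
      shareRule U (simplexPoint (Fin.cons c z : Fin (m + 1) → ℝ)) C -
        shareRule U (simplexPoint (Fin.cons c z : Fin (m + 1) → ℝ)) D)
      (scaledDirichlet m α (1 - c)) := fun C D => (hint C).sub (hint D)
  -- Here s is agent 1's contribution to the coalition: c when it has joined, 0 otherwise.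
  have hI : ∀ (s : ℝ) (C : Finset (Fin (m + 2))) (D : Finset (Fin (m + 1))),
      (∀ z : Fin m → ℝ, ∑ i ∈ C, simplexPoint (Fin.cons c z : Fin (m + 1) → ℝ) i =
        s + ∑ i ∈ D, (Fin.snoc z (1 - c - ∑ i, z i) : Fin (m + 1) → ℝ) i) →
      (∫ z : Fin m → ℝ, shareRule U (simplexPoint (Fin.cons c z : Fin (m + 1) → ℝ)) C
        ∂(scaledDirichlet m α (1 - c))) / (scaledDirichlet m α (1 - c)).real Set.univ =
      coalitionProb m α (1 - c) U s D := by
    intro s C D h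
    have hm : Measurable fun z : Fin m → ℝ =>
        s + ∑ i ∈ D, (Fin.snoc z (1 - c - ∑ i, z i) : Fin (m + 1) → ℝ) i := by
      simp only [← h]
      exact Finset.measurable_sum _ fun i _ => (measurable_pi_apply i).comp hT
    simp only [shareRule_simplexPoint, h]
    rw [coalitionProb]
    congr 1
    exact integral_indicator_one (hm hUm)
  rw [dirichletCondMean_eq_integral_div m hα hc]
  simp only [banzhafIndex_zero]
  rw [integral_const_mul, integral_finsetSum _ fun C _ => hint₂ _ _, mul_div_assoc,
    Finset.sum_div]
  congr 1
  refine Finset.sum_congr rfl fun C _ => ?_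
  rw [integral_sub (hint _) (hint _), sub_div]
  congr 1
  · refine hI c _ C fun z => ?_
    rw [simplexPoint_cons, Finset.sum_insert (by simp), Finset.sum_map]
    simp
  · refine hI 0 _ C fun z => ?_
    rw [simplexPoint_cons, Finset.sum_map]
    simp

open scoped Classical in
lemma dirichletCondMean_banzhafIndex_eq_sum (m : ℕ) {α c θ : ℝ} (hα : 0 < α) (hc : 0 < c)
    (hc1 : c < 1) {U : Set ℝ} (hUm : MeasurableSet U) (hU : Set.Ioi θ ⊆ U) (hU' : U ⊆ Set.Ici θ)
    (h0 : 0 ∉ U) (h1 : 1 ∈ U) :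
    dirichletCondMean m (fun _ => α) (fun x => banzhafIndex (shareRule U x) 0) c =
      (∑ k ∈ Finset.Icc 1 m, ((m + 1).choose k : ℝ) / 2 ^ (m + 1) *
        (betaCdf (m + 2) (θ / (1 - c)) k α - betaCdf (m + 2) ((θ - c) / (1 - c)) k α)) +
      1 / 2 ^ (m + 1) * ((if c ∈ U then 1 else 0) + (1 - if 1 - c ∈ U then 1 else 0)) := by
  have hr : 0 < 1 - c := sub_pos.2 hc1
  -- The swing probability by coalition size; sizes 0 and m + 1 are the deterministic extremes,
  -- where 0 ∉ U and 1 ∈ U decide one of the two terms.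
  let g : ℕ → ℝ := fun k => if k = 0 then (if c ∈ U then 1 else 0) else
    if k = m + 1 then (1 - if 1 - c ∈ U then 1 else 0) else
      betaCdf (m + 2) (θ / (1 - c)) k α - betaCdf (m + 2) ((θ - c) / (1 - c)) k α
  have hg : ∀ C : Finset (Fin (m + 1)),
      coalitionProb m α (1 - c) U c C - coalitionProb m α (1 - c) U 0 C = g C.card := by
    intro C
    rcases C.eq_empty_or_nonempty with rfl | hC
    · rw [coalitionProb_empty m hα hr, coalitionProb_empty m hα hr]
      simp [g, h0, Set.indicator]
    by_cases hC' : C = Finset.univ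
    · subst hC'
      rw [coalitionProb_univ m hα hr, coalitionProb_univ m hα hr]
      simp [g, h1, Set.indicator]
    · have hcard : C.card ≠ m + 1 := fun h => hC' ((Finset.card_eq_iff_eq_univ C).1
        (h.trans (Fintype.card_fin _).symm))
      rw [coalitionProb_eq_one_sub_betaCdf hα hr hUm hU hU' _ hC hC',
        coalitionProb_eq_one_sub_betaCdf hα hr hUm hU hU' _ hC hC']
      simp only [g, hC.card_pos.ne', hcard, if_false, sub_zero]
      ring
  rw [dirichletCondMean_banzhafIndex m hα hc hc1 hUm, Finset.sum_congr rfl fun C _ => hg C,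
    Finset.sum_powerset_apply_card, Finset.card_univ, Fintype.card_fin, Finset.sum_range_succ,
    Finset.sum_range_succ', Finset.range_eq_Ico,
    Finset.sum_Ico_add' (fun k => (m + 1).choose k • g k) 0 m 1]
  have hIcc : Finset.Ico (0 + 1) (m + 1) = Finset.Icc 1 m := by ext; simp
  have hk : ∀ k ∈ Finset.Icc 1 m, (m + 1).choose k • g k = ((m + 1).choose k : ℝ) *
      (betaCdf (m + 2) (θ / (1 - c)) k α - betaCdf (m + 2) ((θ - c) / (1 - c)) k α) := by
    intro k hk
    have := Finset.mem_Icc.1 hk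
    simp only [g, nsmul_eq_mul]
    rw [if_neg (by omega), if_neg (by omega)]
  rw [hIcc, Finset.sum_congr rfl hk, add_assoc, mul_add, Finset.mul_sum]
  congr 1
  · exact Finset.sum_congr rfl fun k _ => by ring
  · simp [g]

/-! ### From the uniform formula to the piecewise one. -/

lemma betaCdf_of_nonpos (n k : ℕ) {h : ℝ} (α : ℝ) (hh : h ≤ 0) : betaCdf n h k α = 0 := by
  rw [betaCdf, incompleteBeta, max_eq_left ((min_le_left _ _).trans hh),
    intervalIntegral.integral_same, zero_div]

lemma betaCdf_of_one_le {m k : ℕ} {α h : ℝ} (hα : 0 < α) (hk : 0 < k) (hkm : k ≤ m)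
    (hh : 1 ≤ h) : betaCdf (m + 2) h k α = 1 := by
  have hkm' : (k : ℝ) ≤ m := by exact_mod_cast hkm
  have hp : 0 < (k : ℝ) * α := by positivity
  have hq : 0 < (((m + 2 : ℕ) : ℝ) - 1 - k) * α := mul_pos (by push_cast; linarith) hα
  have hne := (beta_pos hp hq).ne'
  rw [← betaFunction_eq hp hq] at hne
  rw [betaCdf, incompleteBeta, min_eq_right hh, max_eq_right zero_le_one]
  exact div_self hne

lemma sum_Icc_choose_div_two_pow (m : ℕ) :
    ∑ k ∈ Finset.Icc 1 m, ((m + 1).choose k : ℝ) / 2 ^ (m + 1) = 1 - 2 / 2 ^ (m + 1) := by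
  have h := Nat.sum_range_choose (m + 1)
  rw [Finset.sum_range_succ, Finset.sum_range_succ', Finset.range_eq_Ico,
    Finset.sum_Ico_add' (fun k => (m + 1).choose k) 0 m 1,
    show Finset.Ico (0 + 1) (m + 1) = Finset.Icc 1 m by ext; simp] at h
  have h' : ∑ k ∈ Finset.Icc 1 m, ((m + 1).choose k : ℝ) + 1 + 1 = 2 ^ (m + 1) := by
    simpa using congrArg (Nat.cast (R := ℝ)) h
  rw [← Finset.sum_div, eq_sub_of_add_eq (eq_sub_of_add_eq h')]
  field_simp
  ring

/-- The hypotheses `hcU` and `hcU'` say that ties at c and 1 - c count as losing, which is what the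
placement of the weak inequalities in the formula requires. -/
theorem isBanzhafValue_dirichletCondMean (m : ℕ) {α c θ : ℝ} (hα : 0 < α) (hc : 0 < c)
    (hc1 : c < 1) {U : Set ℝ} (hUm : MeasurableSet U) (hU : Set.Ioi θ ⊆ U)
    (hU' : U ⊆ Set.Ici θ) (h0 : 0 ∉ U) (h1 : 1 ∈ U) (hcU : c ∈ U ↔ θ < c)
    (hcU' : 1 - c ∈ U ↔ θ < 1 - c) (hhalf : ¬ (c = 1 / 2 ∧ θ = 1 / 2)) :
    IsBanzhafValue (m + 2) α θ c
      (dirichletCondMean m (fun _ => α) (fun x => banzhafIndex (shareRule U x) 0) c) := by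
  classical
  have hr : 0 < 1 - c := sub_pos.2 hc1
  rw [dirichletCondMean_banzhafIndex_eq_sum m hα hc hc1 hUm hU hU' h0 h1]
  simp only [hcU, hcU']
  have hΔ1 : 1 - θ ≤ c → ∀ k ∈ Finset.Icc 1 m, betaCdf (m + 2) (θ / (1 - c)) k α = 1 :=
    fun h k hk => betaCdf_of_one_le hα (Finset.mem_Icc.1 hk).1 (Finset.mem_Icc.1 hk).2
      ((one_le_div hr).2 (by linarith))
  have hΔ0 : θ ≤ c → ∀ k, betaCdf (m + 2) ((θ - c) / (1 - c)) k α = 0 :=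
    fun h k => betaCdf_of_nonpos _ _ _ (div_nonpos_of_nonpos_of_nonneg (by linarith) hr.le)
  -- Every coalition is swung: each Δ difference is 1, and the two extremes supply the missing 2 / 2
  -- ^ (m + 1).
  have hone : θ < c → 1 - θ ≤ c →
      (∑ k ∈ Finset.Icc 1 m, ((m + 1).choose k : ℝ) / 2 ^ (m + 1) *
        (betaCdf (m + 2) (θ / (1 - c)) k α - betaCdf (m + 2) ((θ - c) / (1 - c)) k α)) +
      1 / 2 ^ (m + 1) * ((if θ < c then 1 else 0) + (1 - if θ < 1 - c then 1 else 0)) = 1 := by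
    intro h h'
    rw [Finset.sum_congr rfl fun k hk => by rw [hΔ1 h' k hk, hΔ0 h.le, sub_zero, mul_one],
      sum_Icc_choose_div_two_pow, if_pos h, if_neg (by linarith)]
    ring
  refine ⟨fun hθ => ⟨fun _ h => ?_, fun h h' => ?_, fun h _ => ?_⟩,
    fun hθ => ⟨fun _ h => ?_, fun _ _ h h' => ?_, fun h _ => ?_⟩⟩
  -- With c ≤ θ ≤ 1/2, failure would force c = θ = 1/2, the point where the clauses overlap.
  · have : θ < 1 - c := by
      by_contra hle
      exact hhalf ⟨by linarith, by linarith⟩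
    rw [if_neg (by linarith), if_pos this]
    simp
  · rw [if_pos h, if_pos (by linarith)]
    simp
  · refine hone (lt_of_not_ge fun hle => hhalf ⟨by linarith, by linarith⟩) h
  · rw [if_neg (by linarith), if_pos (by linarith)]
    simp
  · rw [if_neg (by linarith), if_neg (by linarith),
      Finset.sum_congr rfl fun k hk => by rw [hΔ1 h k hk]]
    simp
  · exact hone h (by linarith)

/-! ### Conditional density and regular conditional distribution. -/

lemma integral_fin_succ {p : ℕ} {f : (Fin (p + 1) → ℝ) → ℝ} (hf : Integrable f) :
    ∫ x, f x = ∫ a : ℝ, ∫ y : Fin p → ℝ, f (Fin.cons a y) := by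
  have e := (volume_preserving_piFinSuccAbove (fun _ : Fin (p + 1) => ℝ) 0).symm
  rw [← e.integral_comp', Measure.volume_eq_prod, integral_prod]
  · simp [MeasurableEquiv.piFinSuccAbove_symm_apply, Fin.insertNthEquiv]
  · exact e.integrable_comp_of_integrable hf

lemma integrable_fin_cons {p : ℕ} {f : (Fin (p + 1) → ℝ) → ℝ} (hf : Integrable f) :
    ∀ᵐ a : ℝ, Integrable fun y : Fin p → ℝ => f (Fin.cons a y) := by
  have e := (volume_preserving_piFinSuccAbove (fun _ : Fin (p + 1) => ℝ) 0).symm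
  have h := (e.integrable_comp_of_integrable hf).prod_right_ae
  simpa [MeasurableEquiv.piFinSuccAbove_symm_apply, Fin.insertNthEquiv] using h

lemma simplexPoint_zero {d : ℕ} (y : Fin (d + 1) → ℝ) : simplexPoint y 0 = y 0 := by
  rw [simplexPoint, ← Fin.castSucc_zero, Fin.snoc_castSucc]

section

variable {Ω : Type*} [MeasurableSpace Ω] {P : Measure Ω} [IsProbabilityMeasure P] {m : ℕ}
  {a : Fin (m + 2) → ℝ} {X : Ω → Fin (m + 2) → ℝ}

/-- Since X has this law under a probability measure, the density has total mass 1; the normalizing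
constant need not be evaluated. -/
lemma integrable_dirichletDensity (ha : ∀ i, 0 < a i) (hX : HasLaw X (dirichletMeasure a) P) :
    Integrable fun y : Fin (m + 1) → ℝ => dirichletDensity a (simplexPoint y) := by
  have hm : Measurable fun y : Fin (m + 1) → ℝ => dirichletDensity a (simplexPoint y) :=
    (measurable_dirichletDensity a).comp measurable_simplexPoint
  refine ⟨hm.aestronglyMeasurable, ?_⟩
  rw [hasFiniteIntegral_iff_ofReal
    (Filter.Eventually.of_forall fun y => dirichletDensity_nonneg ha _)]
  have h1 : dirichletMeasure a Set.univ = 1 := by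
    rw [← hX.map_eq]
    have := Measure.isProbabilityMeasure_map (μ := P) hX.aemeasurable
    exact measure_univ
  rw [dirichletMeasure, Measure.map_apply measurable_simplexPoint MeasurableSet.univ,
    Set.preimage_univ, withDensity_apply _ MeasurableSet.univ, Measure.restrict_univ] at h1
  rw [h1]
  exact ENNReal.one_lt_top

lemma integral_comp_eq_iterated (ha : ∀ i, 0 < a i) (hX : HasLaw X (dirichletMeasure a) P)
    {F : (Fin (m + 2) → ℝ) → ℝ} (hF : Measurable F) (hF1 : ∀ x, |F x| ≤ 1) :
    ∫ ω, F (X ω) ∂P = ∫ c : ℝ, ∫ z : Fin m → ℝ,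
      F (simplexPoint (Fin.cons c z : Fin (m + 1) → ℝ)) *
        dirichletDensity a (simplexPoint (Fin.cons c z : Fin (m + 1) → ℝ)) := by
  have hm : Measurable fun y : Fin (m + 1) → ℝ => dirichletDensity a (simplexPoint y) :=
    (measurable_dirichletDensity a).comp measurable_simplexPoint
  rw [← integral_map hX.aemeasurable hF.aestronglyMeasurable, hX.map_eq, dirichletMeasure,
    integral_map measurable_simplexPoint.aemeasurable hF.aestronglyMeasurable,
    integral_withDensity_eq_integral_toReal_smul hm.ennreal_ofReal
      (Filter.Eventually.of_forall fun y => ENNReal.ofReal_lt_top)]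
  simp only [ENNReal.toReal_ofReal (dirichletDensity_nonneg ha _), smul_eq_mul]
  rw [integral_fin_succ]
  · simp only [mul_comm (dirichletDensity a _)]
  · exact (integrable_dirichletDensity ha hX).mul_bdd (c := 1)
      (hF.comp measurable_simplexPoint).aestronglyMeasurable
      (Filter.Eventually.of_forall fun y => hF1 _)

lemma measurable_dirichletCondMean {g : (Fin (m + 2) → ℝ) → ℝ} (hg : Measurable g) :
    Measurable (dirichletCondMean m a g) := by
  have hD := measurable_dirichletDensity a
  have hc := measurable_simplexPoint.comp (measurable_fin_cons (p := m))
  exact (((hg.comp hc).mul (hD.comp hc)).stronglyMeasurable.integral_prod_right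
    (f := fun (c : ℝ) (z : Fin m → ℝ) => g (simplexPoint (Fin.cons c z : Fin (m + 1) → ℝ)) *
      dirichletDensity a (simplexPoint (Fin.cons c z : Fin (m + 1) → ℝ)))).measurable.div
    ((hD.comp hc).stronglyMeasurable.integral_prod_right
    (f := fun (c : ℝ) (z : Fin m → ℝ) =>
      dirichletDensity a (simplexPoint (Fin.cons c z : Fin (m + 1) → ℝ)))).measurable

lemma abs_integral_mul_dirichletDensity_le (ha : ∀ i, 0 < a i) {g : (Fin (m + 2) → ℝ) → ℝ}
    (hg1 : ∀ x, |g x| ≤ 1) {c : ℝ} (hc : Integrable fun z : Fin m → ℝ =>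
      dirichletDensity a (simplexPoint (Fin.cons c z : Fin (m + 1) → ℝ))) :
    |∫ z : Fin m → ℝ, g (simplexPoint (Fin.cons c z : Fin (m + 1) → ℝ)) *
      dirichletDensity a (simplexPoint (Fin.cons c z : Fin (m + 1) → ℝ))| ≤
    ∫ z : Fin m → ℝ, dirichletDensity a (simplexPoint (Fin.cons c z : Fin (m + 1) → ℝ)) := by
  rw [← Real.norm_eq_abs]
  refine norm_integral_le_of_norm_le hc (Filter.Eventually.of_forall fun z => ?_)
  have h := dirichletDensity_nonneg ha (simplexPoint (Fin.cons c z : Fin (m + 1) → ℝ))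
  rw [norm_mul, Real.norm_of_nonneg h]
  exact mul_le_of_le_one_left h (hg1 _)

lemma abs_dirichletCondMean_le (ha : ∀ i, 0 < a i) {g : (Fin (m + 2) → ℝ) → ℝ}
    (hg1 : ∀ x, |g x| ≤ 1) (c : ℝ) : |dirichletCondMean m a g c| ≤ 1 := by
  rw [dirichletCondMean]
  by_cases hc : Integrable fun z : Fin m → ℝ =>
      dirichletDensity a (simplexPoint (Fin.cons c z : Fin (m + 1) → ℝ))
  · have h0 : 0 ≤ ∫ z : Fin m → ℝ,
        dirichletDensity a (simplexPoint (Fin.cons c z : Fin (m + 1) → ℝ)) :=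
      integral_nonneg fun z => dirichletDensity_nonneg ha _
    rw [abs_div, abs_of_nonneg h0]
    exact div_le_one_of_le₀ (abs_integral_mul_dirichletDensity_le ha hg1 hc) h0
  -- A nonintegrable slice has denominator 0 by convention, so the quotient is 0.
  · rw [integral_undef hc, div_zero, abs_zero]
    exact zero_le_one

lemma setIntegral_dirichletCondMean (ha : ∀ i, 0 < a i) (hX : HasLaw X (dirichletMeasure a) P)
    {g : (Fin (m + 2) → ℝ) → ℝ} (hg : Measurable g) (hg1 : ∀ x, |g x| ≤ 1) {s : Set ℝ}
    (hs : MeasurableSet s) :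
    ∫ ω, s.indicator 1 (X ω 0) * dirichletCondMean m a g (X ω 0) ∂P =
      ∫ ω, s.indicator 1 (X ω 0) * g (X ω) ∂P := by
  have hind : ∀ {t : ℝ} (c : ℝ), |t| ≤ 1 → |s.indicator 1 c * t| ≤ 1 := fun {t} c ht => by
    by_cases hc : c ∈ s <;> simp [hc, ht]
  have hs0 : Measurable fun x : Fin (m + 2) → ℝ => s.indicator (1 : ℝ → ℝ) (x 0) :=
    (measurable_one.indicator hs).comp (measurable_pi_apply 0)
  have hψ : Measurable fun x : Fin (m + 2) → ℝ => dirichletCondMean m a g (x 0) :=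
    (measurable_dirichletCondMean hg).comp (measurable_pi_apply 0)
  rw [integral_comp_eq_iterated ha hX
      (F := fun x => s.indicator 1 (x 0) * dirichletCondMean m a g (x 0)) (hs0.mul hψ)
      (fun x => hind _ (abs_dirichletCondMean_le ha hg1 _)),
    integral_comp_eq_iterated ha hX
      (F := fun x => s.indicator 1 (x 0) * g x) (hs0.mul hg) (fun x => hind _ (hg1 x))]
  refine integral_congr_ae ?_
  filter_upwards [integrable_fin_cons (integrable_dirichletDensity ha hX)] with c hc
  simp only [simplexPoint_zero, Fin.cons_zero, mul_assoc]
  rw [integral_const_mul, integral_const_mul, integral_const_mul, dirichletCondMean]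
  congr 1
  -- On a slice of zero mass the numerator vanishes too, because |g| ≤ 1.
  refine div_mul_cancel_of_imp fun h0 => ?_
  have h := abs_integral_mul_dirichletDensity_le ha hg1 hc
  rw [h0] at h
  exact abs_nonpos_iff.1 h

/-- The conditional density computes the regular conditional distribution. -/
theorem integral_condDistrib_ae_eq_dirichletCondMean (ha : ∀ i, 0 < a i)
    (hX : HasLaw X (dirichletMeasure a) P) {g : (Fin (m + 2) → ℝ) → ℝ} (hg : Measurable g)
    (hg1 : ∀ x, |g x| ≤ 1) :
    (fun c => ∫ x, g x ∂(condDistrib X (fun ω => X ω 0) P c)) =ᵐ[P.map fun ω => X ω 0]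
      dirichletCondMean m a g := by
  have hX0 : AEMeasurable (fun ω => X ω 0) P := by
    exact (measurable_pi_apply 0).comp_aemeasurable hX.aemeasurable
  have := Measure.isProbabilityMeasure_map (μ := P) hX0
  have hκm : StronglyMeasurable fun c => ∫ x, g x ∂(condDistrib X (fun ω => X ω 0) P c) :=
    hg.stronglyMeasurable.integral_kernel
  refine Integrable.ae_eq_of_forall_setIntegral_eq _ _ ?_ ?_ fun s hs _ => ?_
  · refine Integrable.of_bound hκm.aestronglyMeasurable 1 (Filter.Eventually.of_forall fun c => ?_)
    refine (norm_integral_le_of_norm_le_const (Filter.Eventually.of_forall hg1)).trans ?_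
    simp
  · exact Integrable.of_bound (measurable_dirichletCondMean hg).aestronglyMeasurable 1
      (Filter.Eventually.of_forall fun c => abs_dirichletCondMean_le ha hg1 c)
  · have hint : Integrable (fun p : ℝ × (Fin (m + 2) → ℝ) => g p.2)
        ((P.map fun ω => X ω 0) ⊗ₘ condDistrib X (fun ω => X ω 0) P) :=
      Integrable.of_bound (hg.comp measurable_snd).aestronglyMeasurable 1
        (Filter.Eventually.of_forall fun p => hg1 p.2)
    -- Composing the law of X₁ with the kernel gives the joint law of (X₁, X), turning the kernel
    -- integral over s into the integral of g(X) over {X₁ ∈ s}.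
    have h1 := Measure.setIntegral_compProd hs MeasurableSet.univ hint.integrableOn
    simp only [Measure.restrict_univ] at h1
    rw [← h1, compProd_map_condDistrib hX.aemeasurable,
      ← integral_indicator (hs.prod MeasurableSet.univ), ← integral_indicator hs,
      integral_map hX0 ((measurable_dirichletCondMean hg).indicator hs).aestronglyMeasurable,
      integral_map (hX0.prodMk hX.aemeasurable) ((by fun_prop : Measurable
        fun p : ℝ × (Fin (m + 2) → ℝ) => g p.2).indicator (hs.prod MeasurableSet.univ)).aestronglyMeasurable]
    have h2 := setIntegral_dirichletCondMean ha hX hg hg1 hs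
    refine Eq.trans (integral_congr_ae (Filter.Eventually.of_forall fun ω => ?_))
      (h2.symm.trans (integral_congr_ae (Filter.Eventually.of_forall fun ω => ?_)))
    · by_cases h : X ω 0 ∈ s <;> simp [h]
    · by_cases h : X ω 0 ∈ s <;> simp [h]

end

/-! ### Exceptional points and the two senses of the formula. -/

lemma ae_ne_map_dirichlet {Ω : Type*} [MeasurableSpace Ω] {P : Measure Ω} {m : ℕ}
    {a : Fin (m + 2) → ℝ} {X : Ω → Fin (m + 2) → ℝ} (hX : HasLaw X (dirichletMeasure a) P) (b : ℝ) :
    ∀ᵐ c ∂(P.map fun ω => X ω 0), c ≠ b := by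
  have h0 : Measurable fun x : Fin (m + 2) → ℝ => x 0 := measurable_pi_apply 0
  have hmap : (P.map fun ω => X ω 0) = (dirichletMeasure a).map fun x => x 0 := by
    rw [← hX.map_eq, AEMeasurable.map_map_of_aemeasurable h0.aemeasurable hX.aemeasurable]
    rfl
  rw [hmap, dirichletMeasure, Measure.map_map h0 measurable_simplexPoint,
    ae_map_iff (h0.comp measurable_simplexPoint).aemeasurable 
      (p := fun c => c ≠ b) (measurableSet_singleton b).compl]
  refine (withDensity_absolutelyContinuous _ _).ae_le ?_
  simp only [Function.comp_apply, simplexPoint_zero]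
  have h := Measure.pi_hyperplane (fun _ : Fin (m + 1) => (volume : Measure ℝ)) 0 b
  exact measure_mono_null (fun y hy => not_not.1 hy) h

/-- Each clause forces 0 < c < 1, so outside this interval all hold vacuously; the support of the
law of X₁ need not be determined. -/
lemma IsBanzhafValue.of_notMem_Ioo {n : ℕ} {α θ c v : ℝ} (hθ0 : 0 ≤ θ)
    (hc : c ∉ Set.Ioo (0 : ℝ) 1) : IsBanzhafValue n α θ c v := by
  have hc : 0 < c → c < 1 → False := fun h h' => hc ⟨h, h'⟩
  refine ⟨fun hθ => ⟨fun h h' => ?_, fun h h' => ?_, fun h h' => ?_⟩,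
    fun hθ => ⟨fun h h' => ?_, fun h h' => ?_, fun h h' => ?_⟩⟩ <;>
  exact (hc (by linarith) (by linarith)).elim

theorem ae_isBanzhafValue_condDistrib {Ω : Type*} [MeasurableSpace Ω] {P : Measure Ω}
    [IsProbabilityMeasure P] {m : ℕ} {α θ : ℝ} (hα : 0 < α) (hθ0 : 0 ≤ θ)
    {X : Ω → Fin (m + 2) → ℝ} (hX : HasLaw X (dirichletMeasure fun _ => α) P) {U : Set ℝ}
    (hUm : MeasurableSet U) (hU : Set.Ioi θ ⊆ U) (hU' : U ⊆ Set.Ici θ) (h0 : 0 ∉ U) (h1 : 1 ∈ U) :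
    ∀ᵐ c ∂(P.map fun ω => X ω 0), IsBanzhafValue (m + 2) α θ c
      (∫ x, banzhafIndex (shareRule U x) 0 ∂(condDistrib X (fun ω => X ω 0) P c)) := by
  have hmem : ∀ {t : ℝ}, t ≠ θ → (t ∈ U ↔ θ < t) := fun {t} ht =>
    ⟨fun h => lt_of_le_of_ne (hU' h) ht.symm, fun h => hU h⟩
  filter_upwards [integral_condDistrib_ae_eq_dirichletCondMean (fun _ => hα) hX
    (measurable_banzhafIndex_shareRule hUm 0) fun x => abs_banzhafIndex_shareRule_le U x 0,
    ae_ne_map_dirichlet hX θ, ae_ne_map_dirichlet hX (1 - θ), ae_ne_map_dirichlet hX (1 / 2)]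
    with c hc hcθ hcθ' hch
  by_cases hI : c ∈ Set.Ioo (0 : ℝ) 1
  · rw [hc]
    exact isBanzhafValue_dirichletCondMean m hα hI.1 hI.2 hUm hU hU' h0 h1 (hmem hcθ)
      (hmem fun h => hcθ' (by linarith)) fun h => hch h.1
  · exact .of_notMem_Ioo hθ0 hI

theorem mainTheorem3 {Ω : Type*} [MeasurableSpace Ω] (P : Measure Ω) [IsProbabilityMeasure P]
    (m : ℕ) (α θ : ℝ) (hα : 0 < α) (hθ0 : 0 ≤ θ) (hθ1 : θ ≤ 1)
    (X : Ω → Fin (m + 2) → ℝ) (hX : HasLaw X (dirichletMeasure fun _ => α) P) :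
    (0 < θ →
      (∀ᵐ c ∂(P.map fun ω => X ω 0), IsBanzhafValue (m + 2) α θ c
        (∫ x, banzhafIndex (quotaRule θ x) 0 ∂(condDistrib X (fun ω => X ω 0) P c))) ∧
      ∀ c : ℝ, 0 < c → c < 1 → c ≠ θ → c ≠ 1 - θ →
        IsBanzhafValue (m + 2) α θ c
          (dirichletCondMean m (fun _ => α)
            (fun x => banzhafIndex (quotaRule θ x) 0) c)) ∧
    (θ < 1 →
      (∀ᵐ c ∂(P.map fun ω => X ω 0), IsBanzhafValue (m + 2) α θ c
        (∫ x, banzhafIndex (strictQuotaRule θ x) 0 ∂(condDistrib X (fun ω => X ω 0) P c))) ∧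
      ∀ c : ℝ, 0 < c → c < 1 → ¬ (c = 1 / 2 ∧ θ = 1 / 2) →
        IsBanzhafValue (m + 2) α θ c
          (dirichletCondMean m (fun _ => α)
            (fun x => banzhafIndex (strictQuotaRule θ x) 0) c)) := by
  rw [quotaRule_eq_shareRule, strictQuotaRule_eq_shareRule]
  refine ⟨fun hθ => ⟨?_, fun c hc hc1 hcθ hcθ' => ?_⟩, fun hθ => ⟨?_, fun c hc hc1 hch => ?_⟩⟩
  · exact ae_isBanzhafValue_condDistrib hα hθ0 hX measurableSet_Ici Set.Ioi_subset_Ici_self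
      subset_rfl (not_le.2 hθ) hθ1
  · refine isBanzhafValue_dirichletCondMean m hα hc hc1 measurableSet_Ici Set.Ioi_subset_Ici_self
      subset_rfl (not_le.2 hθ) hθ1 
      ⟨fun h => lt_of_le_of_ne h hcθ.symm, fun h => le_of_lt h⟩ ?_ ?_
    · exact ⟨fun h => lt_of_le_of_ne h fun h' => hcθ' (by linarith), fun h => le_of_lt h⟩
    · exact fun h => hcθ (h.1.trans h.2.symm)
  · exact ae_isBanzhafValue_condDistrib hα hθ0 hX measurableSet_Ioi subset_rfl
      Set.Ioi_subset_Ici_self (not_lt.2 hθ0) hθ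
  · exact isBanzhafValue_dirichletCondMean m hα hc hc1 measurableSet_Ioi subset_rfl
      Set.Ioi_subset_Ici_self (not_lt.2 hθ0) hθ Iff.rfl Iff.rfl hch

end
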